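/- For $n\ge 0$ let $\mathcal M_{2n}$ be the set of matchings of $[2n]=\{1,\dots,2n\}$, i.e. of partitions of $[2n]$ into $n$ two-element blocks. Each block $\{i,j\}$ with $i<j$ of a matching is regarded as an edge $(i,j)$. Two edges $(i_1,j_1)$, $(i_2,j_2)$ form a crossing if $i_1<i_2<j_1<j_2$ and a nesting if $i_1<i_2<j_2<j_1$; let $\mathrm{cr}(\alpha)$ and $\mathrm{ne}(\alpha)$ be the numbers of crossings and nestings of $\alpha\in\mathcal M_{2n}$. Put $$L_n(p,q)=\sum_{\alpha\in\mathcal M_{2n}}p^{\mathrm{cr}(\alpha)}q^{\mathrm{ne}(\alpha)},\qquad [k]_{p,q}=\frac{p^k-q^k}{p-q}=\sum_{i=0}^{k-1}p^iq^{k-1-i}.$$ Then, for indeterminates $p,q$ (equivalently, for arbitrary elements $p,q$ of any commutative ring $R$, with $[k]_{p,q}$ read as the polynomial), the following identity of formal power series in $z$ holds: $$\sum_{n\ge 0}L_n(p,q)\,z^n=\cfrac{1}{1-\cfrac{z}{1-\cfrac{[2]_{p,q}\,z}{1-\cfrac{[3]_{p,q}\,z}{1-\cfrac{[4]_{p,q}\,z}{\cdots}}}}}.$$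 That is, with $[1]_{p,q}=1$, the finite continued fractions $$\cfrac{1}{1-\cfrac{[1]_{p,q}\,z}{1-\cfrac{[2]_{p,q}\,z}{\ddots-\cfrac{\ddots}{1-[N]_{p,q}\,z}}}}$$ converge to the left-hand side as $N\to\infty$ in the sense of formal power series: for each $n$, the coefficient of $z^n$ equals $L_n(p,q)$ for all sufficiently large $N$. -/

import Mathlib

open scoped PowerSeries

namespace CrossNest

/-- The edges of a partition `π` of a finite set of integers: the pairs `(i, j)`, `i < j`, of
consecutive elements of a same block of `π`. -/
def edges {s : Finset ℕ} (π : Finpartition s) : Finset (ℕ × ℕ) :=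
  (s ×ˢ s).filter fun e =>
    e.1 < e.2 ∧ ∃ B ∈ π.parts, e.1 ∈ B ∧ e.2 ∈ B ∧ ∀ x ∈ B, ¬ (e.1 < x ∧ x < e.2)

/-- The number of crossings: pairs of edges `(i₁, j₁)`, `(i₂, j₂)` with `i₁ < i₂ < j₁ < j₂`. -/
def cr {s : Finset ℕ} (π : Finpartition s) : ℕ :=
  ((edges π ×ˢ edges π).filter fun e =>
    e.1.1 < e.2.1 ∧ e.2.1 < e.1.2 ∧ e.1.2 < e.2.2).card

/-- The number of nestings: pairs of edges `(i₁, j₁)`, `(i₂, j₂)` with `i₁ < i₂ < j₂ < j₁`. -/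
def ne {s : Finset ℕ} (π : Finpartition s) : ℕ :=
  ((edges π ×ˢ edges π).filter fun e =>
    e.1.1 < e.2.1 ∧ e.2.1 < e.2.2 ∧ e.2.2 < e.1.2).card

/-- The matchings of `[2n] = {1, …, 2n}`: the partitions of `[2n]` in `n` two-element blocks. -/
def matchings (n : ℕ) : Finset (Finpartition (Finset.Icc 1 (2 * n))) :=
  Finset.univ.filter fun α => α.parts.card = n ∧ ∀ B ∈ α.parts, B.card = 2

/-- `L_n(p, q)`, the sum of `p ^ cr α * q ^ ne α` over the matchings `α` of `[2n]`. -/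
def L {R : Type*} [CommRing R] (p q : R) (n : ℕ) : R :=
  ∑ α ∈ matchings n, p ^ cr α * q ^ ne α

/-- `[n]_{p,q} = (p ^ n - q ^ n) / (p - q)`, as the polynomial `∑_{i < n} p ^ i q ^ (n - 1 - i)`. -/
def pqNumber {R : Type*} [CommRing R] (p q : R) (n : ℕ) : R :=
  ∑ i ∈ Finset.range n, p ^ i * q ^ (n - 1 - i)

theorem pqNumber_mul_sub {R : Type*} [CommRing R] (p q : R) (n : ℕ) :
    pqNumber p q n * (p - q) = p ^ n - q ^ n :=
  (Commute.all p q).geom_sum₂_mul n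

theorem pqNumber_eq_div {K : Type*} [Field K] {p q : K} (h : p ≠ q) (n : ℕ) :
    pqNumber p q n = (p ^ n - q ^ n) / (p - q) := by
  rw [← pqNumber_mul_sub, mul_div_cancel_right₀ _ (sub_ne_zero.mpr h)]

/-- The convergents of the S-fraction `1 / (1 - c₀ z / (1 - c₁ z / (1 - c₂ z / ⋯)))` in `R⟦z⟧`:
the `N`-th one is `1 / (1 - c₀ z / (1 - c₁ z / (⋯ / (1 - c_{N-1} z))))`. -/
noncomputable def sFractionConvergent {R : Type*} [CommRing R] : ℕ → (ℕ → R) → R⟦X⟧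
  | 0, _ => 1
  | N + 1, c =>
      PowerSeries.invOfUnit
        (1 - PowerSeries.C (c 0) * PowerSeries.X * sFractionConvergent N (fun k => c (k + 1))) 1

/-- The power series inverted in the definition of the convergents is really invertible. -/
theorem mul_sFractionConvergent_succ {R : Type*} [CommRing R] (N : ℕ) (c : ℕ → R) :
    (1 - PowerSeries.C (c 0) * PowerSeries.X * sFractionConvergent N (fun k => c (k + 1))) *
      sFractionConvergent (N + 1) c = 1 := by
  rw [sFractionConvergent]
  exact PowerSeries.mul_invOfUnit _ 1 (by simp)

/-- `F = 1 / (1 - c₀ z / (1 - c₁ z / (1 - c₂ z / ⋯)))` in `R⟦z⟧`: the convergents tend to `F` in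
the sense of formal power series, i.e. each coefficient is eventually that of `F`. -/
def IsSFraction {R : Type*} [CommRing R] (F : R⟦X⟧) (c : ℕ → R) : Prop :=
  ∀ n : ℕ, ∀ᶠ N in Filter.atTop,
    PowerSeries.coeff n (sFractionConvergent N c) = PowerSeries.coeff n F

end CrossNest

/-!
Read a matching from left to right, keeping the set `S` of vertices still waiting for a partner.
The next vertex either joins `S` or closes the edge of some `s ∈ S`; in the second case the new
edge crosses the edges of the later elements of `S` and is nested in those of the earlier ones, so
the choice of `s` contributes `∑ i < #S, p ^ i * q ^ (#S - 1 - i) = [#S]`. Hence `L p q n` counts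
Dyck paths of length `2n` whose down steps from height `k + 1` have weight `[k + 1]`.

Let `G h` be the generating function of the Dyck prefixes ending at height `h`, with `G (-1) = 1`.
Removing the last step gives `G h = G (h - 1) + c h * z * G (h + 1)`, so `G h / G (h - 1)` equals
`1 / (1 - c h * z * (G (h + 1) / G h))`, and iterating expands `G 0` into the S-fraction.
-/

namespace CrossNest

open Finset

section SFraction

open PowerSeries

section DyckPrefixSum

variable {R : Type*} [CommSemiring R]

/-- The sum over the paths with `m` steps `±1` from height `0` to height `h` that stay nonnegative
of the products of the weights `c k` of the steps from `k + 1` to `k`. -/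
def dyckPrefixSum (c : ℕ → R) : ℕ → ℕ → R
  | 0, 0 => 1
  | 0, _ + 1 => 0
  | m + 1, 0 => c 0 * dyckPrefixSum c m 1
  | m + 1, h + 1 => dyckPrefixSum c m h + c (h + 1) * dyckPrefixSum c m (h + 2)

theorem dyckPrefixSum_eq_zero_of_lt (c : ℕ → R) {m h : ℕ} (hmh : m < h) :
    dyckPrefixSum c m h = 0 := by
  induction m generalizing h with
  | zero => obtain ⟨h, rfl⟩ := Nat.exists_eq_succ_of_ne_zero hmh.ne'; rfl
  | succ m ih =>
    obtain ⟨h, rfl⟩ := Nat.exists_eq_succ_of_ne_zero (Nat.ne_zero_of_lt hmh)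
    rw [dyckPrefixSum, ih (by omega), ih (by omega), mul_zero, add_zero]

/-- The generating function of the Dyck prefixes ending at height `h`, where `z` marks the down
steps: a prefix with `m` of them has `2 * m + h` steps. -/
def dyckPrefixSeries (c : ℕ → R) (h : ℕ) : R⟦X⟧ :=
  mk fun m => dyckPrefixSum c (2 * m + h) h

theorem dyckPrefixSeries_zero (c : ℕ → R) :
    dyckPrefixSeries c 0 = 1 + C (c 0) * X * dyckPrefixSeries c 1 := by
  ext (_ | m)
  · simp [dyckPrefixSeries, dyckPrefixSum, mul_assoc]
  · simp [dyckPrefixSeries, mul_assoc, coeff_one, mul_add, dyckPrefixSum]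

theorem dyckPrefixSeries_succ (c : ℕ → R) (h : ℕ) :
    dyckPrefixSeries c (h + 1) =
      dyckPrefixSeries c h + C (c (h + 1)) * X * dyckPrefixSeries c (h + 2) := by
  ext (_ | m)
  · simp [dyckPrefixSeries, dyckPrefixSum, mul_assoc,
      dyckPrefixSum_eq_zero_of_lt c (show h < h + 2 by omega)]
  · simp only [dyckPrefixSeries, mul_assoc, map_add, coeff_mk, coeff_C_mul, coeff_succ_X_mul]
    rw [← add_assoc, dyckPrefixSum, mul_add_one, add_right_comm, add_assoc]

end DyckPrefixSum

variable {R : Type*} [CommRing R]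

theorem X_pow_dvd_sub_sFractionConvergent_mul (N : ℕ) {c : ℕ → R} {P : ℕ → R⟦X⟧}
    (hP : ∀ h, P (h + 1) = P h + C (c h) * X * P (h + 2)) :
    X ^ (N + 1) ∣ P 1 - sFractionConvergent N c * P 0 := by
  induction N generalizing c P with
  | zero => exact ⟨C (c 0) * P 2, by rw [sFractionConvergent, hP 0]; ring⟩
  | succ N ih =>
    obtain ⟨A, hA⟩ := ih (c := fun k => c (k + 1)) (P := fun k => P (k + 1)) fun h => hP (h + 1)
    refine ⟨sFractionConvergent (N + 1) c * C (c 0) * A, ?_⟩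
    linear_combination (sFractionConvergent (N + 1) c) * hP 0 -
      P 1 * mul_sFractionConvergent_succ N c + sFractionConvergent (N + 1) c * C (c 0) * X * hA

theorem isSFraction_of_three_term_recurrence {c : ℕ → R} {P : ℕ → R⟦X⟧} (hP₀ : P 0 = 1)
    (hP : ∀ h, P (h + 1) = P h + C (c h) * X * P (h + 2)) : IsSFraction (P 1) c := by
  intro n
  filter_upwards [Filter.eventually_ge_atTop n] with N hN
  have hdvd := X_pow_dvd_sub_sFractionConvergent_mul N hP
  rw [hP₀, mul_one] at hdvd
  have hcoeff := X_pow_dvd_iff.1 hdvd n (Nat.lt_succ_of_le hN)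
  rw [map_sub, sub_eq_zero] at hcoeff
  exact hcoeff.symm

theorem isSFraction_dyckPrefixSeries_zero (c : ℕ → R) : IsSFraction (dyckPrefixSeries c 0) c := by
  let P : ℕ → R⟦X⟧ := fun
    | 0 => 1
    | h + 1 => dyckPrefixSeries c h
  refine isSFraction_of_three_term_recurrence (P := P) rfl ?_
  rintro (_ | h)
  · exact dyckPrefixSeries_zero c
  · exact dyckPrefixSeries_succ c h

end SFraction

section CrossingsNestings

theorem card_filter_insert_product_insert {β : Type*} [DecidableEq β] (r : β → β → Prop)
    [DecidableRel r] {a : β} {E : Finset β} (ha : a ∉ E) (hr : ¬ r a a) :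
    #{e ∈ insert a E ×ˢ insert a E | r e.1 e.2} =
      #{e ∈ E | r a e} + #{e ∈ E | r e a} + #{e ∈ E ×ˢ E | r e.1 e.2} := by
  simp only [card_filter, sum_product, sum_insert ha, sum_add_distrib, if_neg hr]
  ring

variable {α : Type*} [LinearOrder α]

/-- The number of crossings among the edges in `E`. -/
def crossings (E : Finset (α × α)) : ℕ :=
  #{e ∈ E ×ˢ E | e.1.1 < e.2.1 ∧ e.2.1 < e.1.2 ∧ e.1.2 < e.2.2}

/-- The number of nestings among the edges in `E`. -/
def nestings (E : Finset (α × α)) : ℕ :=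
  #{e ∈ E ×ˢ E | e.1.1 < e.2.1 ∧ e.2.1 < e.2.2 ∧ e.2.2 < e.1.2}

variable {s t : α} {E : Finset (α × α)}

theorem crossings_insert_of_forall_lt_snd (ht : ∀ e ∈ E, t < e.2) :
    crossings (insert (s, t) E) = #{e ∈ E | s < e.1 ∧ e.1 < t} + crossings E := by
  have hst : (s, t) ∉ E := fun h => lt_irrefl t (ht _ h)
  rw [crossings, card_filter_insert_product_insert
    (fun e f : α × α => e.1 < f.1 ∧ f.1 < e.2 ∧ e.2 < f.2) hst (by simp), crossings]
  have hleft : {e ∈ E | s < e.1 ∧ e.1 < t ∧ t < e.2} = {e ∈ E | s < e.1 ∧ e.1 < t} :=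
    filter_congr fun e he => by simp [ht e he]
  have hright : {e ∈ E | e.1 < s ∧ s < e.2 ∧ e.2 < t} = ∅ :=
    filter_eq_empty_iff.2 fun e he h => (ht e he).asymm h.2.2
  rw [hleft, hright, card_empty, add_zero]

theorem nestings_insert_of_forall_lt_snd (hst : s < t) (ht : ∀ e ∈ E, t < e.2) :
    nestings (insert (s, t) E) = #{e ∈ E | e.1 < s} + nestings E := by
  have hstE : (s, t) ∉ E := fun h => lt_irrefl t (ht _ h)
  rw [nestings, card_filter_insert_product_insert
    (fun e f : α × α => e.1 < f.1 ∧ f.1 < f.2 ∧ f.2 < e.2) hstE (by simp), nestings]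
  have hleft : {e ∈ E | s < e.1 ∧ e.1 < e.2 ∧ e.2 < t} = ∅ :=
    filter_eq_empty_iff.2 fun e he h => (ht e he).asymm h.2.2
  have hright : {e ∈ E | e.1 < s ∧ s < t ∧ t < e.2} = {e ∈ E | e.1 < s} :=
    filter_congr fun e he => by simp [ht e he, hst]
  rw [hleft, hright, card_empty, zero_add]

end CrossingsNestings

section SuffixMatchings

variable {α : Type*} [LinearOrder α] {S T : Finset α} {E : Finset (α × α)} {s t : α}

/-- `E` is the set of edges of a matching of the disjoint union of `S` and `T` in which each edge
ends in `T`. When `S` precedes `T`, this is what remains of a matching after its vertices before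
`T` have been read, `S` being the vertices still waiting for a partner. That each vertex lies on
exactly one edge is encoded as an equality of multisets. -/
structure IsSuffixMatching (S T : Finset α) (E : Finset (α × α)) : Prop where
  fst_lt_snd : ∀ e ∈ E, e.1 < e.2
  snd_mem : ∀ e ∈ E, e.2 ∈ T
  sum_endpoints : ∑ e ∈ E, ({e.1, e.2} : Multiset α) = S.val + T.val

theorem IsSuffixMatching.mem_or_mem (h : IsSuffixMatching S T E) {e : α × α} (he : e ∈ E) {x : α}
    (hx : x = e.1 ∨ x = e.2) : x ∈ S ∨ x ∈ T := by
  have hmem : x ∈ ∑ e ∈ E, ({e.1, e.2} : Multiset α) :=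
    Multiset.mem_sum.2 ⟨e, he, by simpa using hx⟩
  rw [h.sum_endpoints] at hmem
  simpa using hmem

theorem isSuffixMatching_empty_right : IsSuffixMatching S ∅ E ↔ S = ∅ ∧ E = ∅ := by
  constructor
  · intro h
    have hE : E = ∅ := eq_empty_of_forall_notMem fun e he => notMem_empty _ (h.snd_mem e he)
    exact ⟨by simpa [hE, eq_comm] using h.sum_endpoints, hE⟩
  · rintro ⟨rfl, rfl⟩
    exact ⟨by simp, by simp, by simp⟩

theorem isSuffixMatching_insert_left (htS : t ∉ S) (htT : t ∉ T) :
    IsSuffixMatching (insert t S) T E ↔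
      IsSuffixMatching S (insert t T) E ∧ ∀ e ∈ E, e.2 ≠ t := by
  have hval : (insert t S).val + T.val = S.val + (insert t T).val := by
    rw [insert_val_of_notMem htS, insert_val_of_notMem htT, Multiset.cons_add, Multiset.add_cons]
  constructor
  · rintro ⟨hlt, hsnd, hsum⟩
    exact ⟨⟨hlt, fun e he => mem_insert_of_mem (hsnd e he), hsum.trans hval⟩,
      fun e he het => htT (het ▸ hsnd e he)⟩
  · rintro ⟨⟨hlt, hsnd, hsum⟩, hne⟩
    exact ⟨hlt, fun e he => mem_of_mem_insert_of_ne (hsnd e he) (hne e he), hsum.trans hval.symm⟩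

theorem isSuffixMatching_insert_edge (hsS : s ∈ S) (hst : s < t) (htS : t ∉ S) (htT : t ∉ T)
    (hE : (s, t) ∉ E) :
    IsSuffixMatching S (insert t T) (insert (s, t) E) ↔ IsSuffixMatching (S.erase s) T E := by
  have hsum : ∑ e ∈ insert (s, t) E, ({e.1, e.2} : Multiset α) = S.val + (insert t T).val ↔
      ∑ e ∈ E, ({e.1, e.2} : Multiset α) = (S.erase s).val + T.val := by
    rw [sum_insert hE, insert_val_of_notMem htT, ← insert_erase hsS,
      insert_val_of_notMem (notMem_erase s S), erase_insert (notMem_erase s S)]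
    simp only [Multiset.insert_eq_cons, Multiset.singleton_add, Multiset.cons_add,
      Multiset.add_cons]
    rw [Multiset.cons_swap t s, Multiset.cons_inj_right, Multiset.cons_inj_right]
  constructor
  · intro h
    have herase := hsum.1 h.sum_endpoints
    refine ⟨fun e he => h.fst_lt_snd e (mem_insert_of_mem he), fun e he => ?_, herase⟩
    have hmem : e.2 ∈ ∑ e ∈ E, ({e.1, e.2} : Multiset α) :=
      Multiset.mem_sum.2 ⟨e, he, by simp⟩
    rw [herase] at hmem
    have hsnd := h.snd_mem e (mem_insert_of_mem he)
    simp only [Multiset.mem_add, mem_val, mem_erase, mem_insert] at hmem hsnd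
    grind
  · intro h
    exact ⟨forall_mem_insert .. |>.2 ⟨hst, h.fst_lt_snd⟩, forall_mem_insert .. |>.2
      ⟨mem_insert_self t T, fun e he => mem_insert_of_mem (h.snd_mem e he)⟩,
      hsum.2 h.sum_endpoints⟩

theorem IsSuffixMatching.card_filter_fst (h : IsSuffixMatching S T E) (P : α → Prop)
    [DecidablePred P] (hP : ∀ x ∈ T, ¬ P x) : #{e ∈ E | P e.1} = #{x ∈ S | P x} := by
  have hcount := congrArg (Multiset.countPAddMonoidHom P) h.sum_endpoints
  simp only [map_sum, map_add, Multiset.coe_countPAddMonoidHom] at hcount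
  have hT : T.val.countP P = 0 := Multiset.countP_eq_zero.2 hP
  have hendpoints : ∀ e ∈ E, Multiset.countP P {e.1, e.2} = if P e.1 then 1 else 0 := fun e he => by
    rw [Multiset.insert_eq_cons, Multiset.countP_cons, Multiset.countP_eq_zero.2, zero_add]
    simpa using hP e.2 (h.snd_mem e he)
  rw [sum_congr rfl hendpoints, ← card_filter, hT, add_zero, Multiset.countP_eq_card_filter]
    at hcount
  exact hcount

theorem IsSuffixMatching.crossings_insert (hS : ∀ x ∈ S, x < t) (hT : ∀ x ∈ T, t < x)
    (h : IsSuffixMatching (S.erase s) T E) :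
    crossings (insert (s, t) E) = #{x ∈ S | s < x} + crossings E := by
  rw [crossings_insert_of_forall_lt_snd fun e he => hT _ (h.snd_mem e he),
    h.card_filter_fst (fun x => s < x ∧ x < t) fun x hx hlt => (hT x hx).asymm hlt.2]
  congr 2
  grind

theorem IsSuffixMatching.nestings_insert (hst : s < t) (hT : ∀ x ∈ T, t < x)
    (h : IsSuffixMatching (S.erase s) T E) :
    nestings (insert (s, t) E) = #{x ∈ S | x < s} + nestings E := by
  rw [nestings_insert_of_forall_lt_snd hst fun e he => hT _ (h.snd_mem e he),
    h.card_filter_fst (· < s) fun x hx hxs => (hT x hx).asymm (hxs.trans hst)]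
  congr 2
  grind

open Classical in
/-- The finset of the edge sets `E` with `IsSuffixMatching S T E`. -/
noncomputable def suffixMatchings (S T : Finset α) : Finset (Finset (α × α)) :=
  {E ∈ ((S ∪ T) ×ˢ T).powerset | IsSuffixMatching S T E}

theorem mem_suffixMatchings : E ∈ suffixMatchings S T ↔ IsSuffixMatching S T E := by
  simp only [suffixMatchings, mem_filter, mem_powerset, and_iff_right_iff_imp]
  exact fun h e he =>
    mem_product.2 ⟨mem_union.2 (h.mem_or_mem he (.inl rfl)), h.snd_mem e he⟩

theorem sum_suffixMatchings_empty_right {M : Type*} [AddCommMonoid M] (S : Finset α)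
    (f : Finset (α × α) → M) :
    ∑ E ∈ suffixMatchings S ∅, f E = if S = ∅ then f ∅ else 0 := by
  split_ifs with hS
  · rw [show suffixMatchings S ∅ = {∅} by
      ext E; simp [mem_suffixMatchings, isSuffixMatching_empty_right, hS], sum_singleton]
  · exact sum_eq_zero fun E hE =>
      absurd (isSuffixMatching_empty_right.1 (mem_suffixMatchings.1 hE)).1 hS

theorem IsSuffixMatching.notMem_of_forall_lt (h : IsSuffixMatching S T E) (hT : ∀ x ∈ T, t < x)
    (s : α) : (s, t) ∉ E := fun he => lt_irrefl t (hT _ (h.snd_mem _ he))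

theorem IsSuffixMatching.exists_eq_insert (hS : ∀ x ∈ S, x < t) (hT : ∀ x ∈ T, t < x)
    (h : IsSuffixMatching S (insert t T) E) (hE : (s, t) ∈ E) :
    s ∈ S ∧ ∃ E', IsSuffixMatching (S.erase s) T E' ∧ insert (s, t) E' = E := by
  have hst : s < t := h.fst_lt_snd _ hE
  have hsS : s ∈ S := by
    refine (h.mem_or_mem hE (.inl rfl)).resolve_right fun hs => ?_
    rcases mem_insert.1 hs with hs | hs
    · exact hst.ne hs
    · exact hst.asymm (hT s hs)
  refine ⟨hsS, E.erase (s, t), ?_, insert_erase hE⟩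
  rw [← isSuffixMatching_insert_edge hsS hst (fun ht => lt_irrefl t (hS t ht))
    (fun ht => lt_irrefl t (hT t ht)) (notMem_erase _ _), insert_erase hE]
  exact h

theorem eq_and_eq_of_insert_edge_eq_insert_edge {E' : Finset (α × α)} {s' : α}
    (hE : ∀ x, (x, t) ∉ E) (hE' : ∀ x, (x, t) ∉ E') (h : insert (s, t) E = insert (s', t) E') :
    s = s' ∧ E = E' := by
  have hmem : (s, t) ∈ insert (s', t) E' := h ▸ mem_insert_self _ _
  have hs : s = s' := congrArg Prod.fst ((mem_insert.1 hmem).resolve_right (hE' s))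
  subst hs
  exact ⟨rfl, by rw [← erase_insert (hE s), h, erase_insert (hE' s)]⟩

theorem sum_suffixMatchings_insert_right {M : Type*} [AddCommMonoid M] (hS : ∀ x ∈ S, x < t)
    (hT : ∀ x ∈ T, t < x) (f : Finset (α × α) → M) :
    ∑ E ∈ suffixMatchings S (insert t T), f E = ∑ E ∈ suffixMatchings (insert t S) T, f E +
      ∑ s ∈ S, ∑ E ∈ suffixMatchings (S.erase s) T, f (insert (s, t) E) := by
  have htS : t ∉ S := fun ht => lt_irrefl t (hS t ht)
  have htT : t ∉ T := fun ht => lt_irrefl t (hT t ht)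
  rw [← sum_filter_add_sum_filter_not (suffixMatchings S (insert t T)) (∀ e ∈ ·, e.2 ≠ t)]
  congr 1
  · refine sum_congr (ext fun E => ?_) fun _ _ => rfl
    rw [mem_filter, mem_suffixMatchings, mem_suffixMatchings, isSuffixMatching_insert_left htS htT]
  · rw [sum_sigma']
    symm
    refine sum_bij (fun a _ => insert (a.1, t) a.2) ?_ ?_ ?_ fun _ _ => rfl
    · rintro ⟨s, E⟩ hE
      obtain ⟨hsS, hE⟩ := mem_sigma.1 hE
      have hE := mem_suffixMatchings.1 hE
      refine mem_filter.2 ⟨mem_suffixMatchings.2 ?_, fun hne => ?_⟩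
      · exact (isSuffixMatching_insert_edge hsS (hS s hsS) htS htT
          (hE.notMem_of_forall_lt hT s)).2 hE
      · exact hne (s, t) (mem_insert_self _ _) rfl
    · rintro ⟨s, E⟩ hE ⟨s', E'⟩ hE' heq
      obtain ⟨rfl, rfl⟩ := eq_and_eq_of_insert_edge_eq_insert_edge
        ((mem_suffixMatchings.1 (mem_sigma.1 hE).2).notMem_of_forall_lt hT)
        ((mem_suffixMatchings.1 (mem_sigma.1 hE').2).notMem_of_forall_lt hT) heq
      rfl
    · intro E hE
      obtain ⟨hE, hclose⟩ := mem_filter.1 hE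
      push Not at hclose
      obtain ⟨⟨s, t⟩, hst, rfl⟩ := hclose
      obtain ⟨hs, E', hE', rfl⟩ := (mem_suffixMatchings.1 hE).exists_eq_insert hS hT hst
      exact ⟨⟨s, E'⟩, mem_sigma.2 ⟨hs, mem_suffixMatchings.2 hE'⟩, rfl⟩

end SuffixMatchings

section WeightedCount

variable {α : Type*} [LinearOrder α] {R : Type*} [CommRing R] (p q : R)

theorem sum_pow_card_filter_lt (S : Finset α) :
    ∑ s ∈ S, p ^ #{x ∈ S | s < x} * q ^ #{x ∈ S | x < s} = pqNumber p q #S := by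
  induction S using induction_on_min with
  | empty => simp [pqNumber]
  | insert a S ha ih =>
    have haS : a ∉ S := fun h => lt_irrefl a (ha a h)
    have hmin : p ^ #{x ∈ insert a S | a < x} * q ^ #{x ∈ insert a S | x < a} = p ^ #S := by
      rw [filter_insert, if_neg (lt_irrefl a), filter_true_of_mem ha, filter_insert,
        if_neg (lt_irrefl a), filter_false_of_mem fun x hx => (ha x hx).not_gt, card_empty,
        pow_zero, mul_one]
    have hrest : ∀ s ∈ S, p ^ #{x ∈ insert a S | s < x} * q ^ #{x ∈ insert a S | x < s} =
        q * (p ^ #{x ∈ S | s < x} * q ^ #{x ∈ S | x < s}) := fun s hs => by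
      rw [filter_insert, if_neg (ha s hs).not_gt, filter_insert, if_pos (ha s hs),
        card_insert_of_notMem fun h => haS (mem_filter.1 h).1]
      ring
    rw [sum_insert haS, hmin, sum_congr rfl hrest, ← mul_sum, ih, card_insert_of_notMem haS]
    exact (geom_sum₂_succ_eq p q).symm

theorem sum_suffixMatchings_insert_edges {S T : Finset α} {t : α} (hS : ∀ x ∈ S, x < t)
    (hT : ∀ x ∈ T, t < x) {w : R}
    (hw : ∀ s ∈ S, ∑ E ∈ suffixMatchings (S.erase s) T, p ^ crossings E * q ^ nestings E = w) :
    ∑ s ∈ S, ∑ E ∈ suffixMatchings (S.erase s) T,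
      p ^ crossings (insert (s, t) E) * q ^ nestings (insert (s, t) E) = pqNumber p q #S * w := by
  rw [← sum_pow_card_filter_lt, sum_mul]
  refine sum_congr rfl fun s hs => ?_
  rw [← hw s hs, mul_sum]
  refine sum_congr rfl fun E hE => ?_
  have hE := mem_suffixMatchings.1 hE
  rw [hE.crossings_insert hS hT, hE.nestings_insert (hS s hs) hT]
  ring

theorem sum_suffixMatchings_pow_crossings_mul_pow_nestings {S T : Finset α}
    (hST : ∀ s ∈ S, ∀ t ∈ T, s < t) :
    ∑ E ∈ suffixMatchings S T, p ^ crossings E * q ^ nestings E =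
      (∏ i ∈ range #S, pqNumber p q (i + 1)) *
        dyckPrefixSum (fun k => pqNumber p q (k + 1)) #T #S := by
  induction T using induction_on_min generalizing S with
  | empty =>
    rw [sum_suffixMatchings_empty_right, card_empty]
    split_ifs with hS
    · simp [hS, crossings, nestings, dyckPrefixSum]
    · rw [dyckPrefixSum_eq_zero_of_lt _ (card_pos.2 (nonempty_iff_ne_empty.2 hS)), mul_zero]
  | insert t T hT ih =>
    have hS : ∀ s ∈ S, s < t := fun s hs => hST s hs t (mem_insert_self t T)
    have htS : t ∉ S := fun h => lt_irrefl t (hS t h)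
    have htT : t ∉ T := fun h => lt_irrefl t (hT t h)
    have hST' : ∀ s ∈ S, ∀ x ∈ T, s < x := fun s hs x hx => (hS s hs).trans (hT x hx)
    have hopen := ih (S := insert t S) (forall_mem_insert .. |>.2 ⟨hT, hST'⟩)
    have hclose := sum_suffixMatchings_insert_edges p q hS hT fun s hs =>
      (ih fun x hx => hST' x (mem_of_mem_erase hx)).trans (by rw [card_erase_of_mem hs])
    rw [sum_suffixMatchings_insert_right hS hT, hopen, hclose, card_insert_of_notMem htS,
      card_insert_of_notMem htT, prod_range_succ]
    rcases #S with _ | h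
    · simp [pqNumber, dyckPrefixSum]
    · rw [prod_range_succ, dyckPrefixSum, Nat.add_sub_cancel]
      ring

end WeightedCount

section Matchings

theorem sum_val_parts {α : Type*} [DecidableEq α] {s : Finset α} (π : Finpartition s) :
    ∑ B ∈ π.parts, B.val = s.val := by
  have hdisj : (π.parts : Set (Finset α)).PairwiseDisjoint id := π.disjoint
  calc ∑ B ∈ π.parts, B.val = ∑ B ∈ π.parts, ∑ x ∈ id B, {x} :=
        sum_congr rfl fun B _ => (sum_multiset_singleton B).symm
    _ = ∑ x ∈ s, {x} := by rw [← sum_biUnion hdisj, π.biUnion_parts]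
    _ = s.val := sum_multiset_singleton s

theorem exists_finpartition_of_sum_val_eq {α : Type*} [DecidableEq α] {s : Finset α}
    {P : Finset (Finset α)} (hP : ∑ B ∈ P, B.val = s.val) (hempty : ∅ ∉ P) :
    ∃ π : Finpartition s, π.parts = P := by
  have hsubset : ∀ B ∈ P, B ⊆ s := fun B hB x hx =>
    show x ∈ s.val from hP ▸ Multiset.mem_sum.2 ⟨B, hB, hx⟩
  have hunique : ∀ x ∈ s, ∃! B, B ∈ P ∧ x ∈ B := fun x hx => by
    have hcard : #{B ∈ P | x ∈ B} = 1 := by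
      calc #{B ∈ P | x ∈ B} = ∑ B ∈ P, B.val.count x := by
            rw [card_filter]
            exact sum_congr rfl fun B _ => (Multiset.count_eq_of_nodup B.nodup).symm
        _ = s.val.count x := by rw [← Multiset.count_sum', hP]
        _ = 1 := Multiset.count_eq_one_of_mem s.nodup hx
    simpa [card_eq_one, singleton_iff_unique_mem] using hcard
  exact ⟨Finpartition.ofExistsUnique P hsubset hunique hempty, rfl⟩

theorem injOn_pair_of_lt {α : Type*} [LinearOrder α] :
    {e : α × α | e.1 < e.2}.InjOn fun e => ({e.1, e.2} : Finset α) := by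
  rintro ⟨i, j⟩ hij ⟨k, l⟩ hkl h
  simp only [Set.mem_ofPred_eq] at hij hkl
  have h' : ({i, j} : Set α) = {k, l} := by simpa using congrArg ((↑) : Finset α → Set α) h
  rcases Set.pair_eq_pair_iff.1 h' with ⟨rfl, rfl⟩ | ⟨rfl, rfl⟩
  · rfl
  · exact absurd hij hkl.asymm

theorem sum_val_image_pair {α : Type*} [LinearOrder α] {E : Finset (α × α)}
    (hE : ∀ e ∈ E, e.1 < e.2) :
    ∑ B ∈ E.image (fun e => ({e.1, e.2} : Finset α)), B.val =
      ∑ e ∈ E, ({e.1, e.2} : Multiset α) := by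
  rw [sum_image (injOn_pair_of_lt.mono hE)]
  exact sum_congr rfl fun e he => insert_val_of_notMem (by simpa using (hE e he).ne)

theorem exists_lt_of_card_eq_two {α : Type*} [LinearOrder α] {B : Finset α} (hB : #B = 2) :
    ∃ i j, i < j ∧ B = {i, j} := by
  obtain ⟨i, j, hij, rfl⟩ := card_eq_two.1 hB
  rcases hij.lt_or_gt with h | h
  · exact ⟨i, j, h, rfl⟩
  · exact ⟨j, i, h, pair_comm i j⟩

variable {s : Finset ℕ} {π : Finpartition s}

theorem mem_edges_iff_of_card_eq_two (hπ : ∀ B ∈ π.parts, #B = 2) {e : ℕ × ℕ} :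
    e ∈ edges π ↔ e.1 < e.2 ∧ {e.1, e.2} ∈ π.parts := by
  simp only [edges, mem_filter, mem_product]
  constructor
  · rintro ⟨-, hlt, B, hB, hfst, hsnd, -⟩
    have hpair : {e.1, e.2} = B := eq_of_subset_of_card_le
      (insert_subset hfst (singleton_subset_iff.2 hsnd)) (by rw [hπ B hB, card_pair hlt.ne])
    exact ⟨hlt, hpair ▸ hB⟩
  · rintro ⟨hlt, hB⟩
    refine ⟨⟨π.le hB (by simp), π.le hB (by simp)⟩, hlt, _, hB, by simp, by simp, fun x hx => ?_⟩
    simp only [mem_insert, mem_singleton] at hx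
    omega

theorem image_pair_edges (hπ : ∀ B ∈ π.parts, #B = 2) :
    (edges π).image (fun e => {e.1, e.2}) = π.parts := by
  ext B
  simp only [mem_image, mem_edges_iff_of_card_eq_two hπ]
  constructor
  · rintro ⟨e, ⟨-, hB⟩, rfl⟩
    exact hB
  · intro hB
    obtain ⟨i, j, hij, rfl⟩ := exists_lt_of_card_eq_two (hπ B hB)
    exact ⟨(i, j), ⟨hij, hB⟩, rfl⟩

theorem isSuffixMatching_edges (hπ : ∀ B ∈ π.parts, #B = 2) :
    IsSuffixMatching ∅ s (edges π) where
  fst_lt_snd e he := ((mem_edges_iff_of_card_eq_two hπ).1 he).1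
  snd_mem e he := (mem_product.1 (mem_filter.1 he).1).2
  sum_endpoints := by
    rw [← sum_val_image_pair fun e he => ((mem_edges_iff_of_card_eq_two hπ).1 he).1,
      image_pair_edges hπ, sum_val_parts, empty_val, zero_add]

theorem IsSuffixMatching.exists_edges_eq {E : Finset (ℕ × ℕ)} (h : IsSuffixMatching ∅ s E) :
    ∃ π : Finpartition s, (∀ B ∈ π.parts, #B = 2) ∧ edges π = E := by
  have hcard : ∀ B ∈ E.image (fun e => ({e.1, e.2} : Finset ℕ)), #B = 2 :=
    forall_mem_image.2 fun e he => card_pair (h.fst_lt_snd e he).ne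
  have hsum : ∑ B ∈ E.image (fun e => ({e.1, e.2} : Finset ℕ)), B.val = s.val := by
    rw [sum_val_image_pair h.fst_lt_snd, h.sum_endpoints, empty_val, zero_add]
  obtain ⟨π, hπ⟩ := exists_finpartition_of_sum_val_eq hsum fun hmem => by simpa using hcard ∅ hmem
  rw [← hπ] at hcard
  refine ⟨π, hcard, ext fun e => ?_⟩
  rw [mem_edges_iff_of_card_eq_two hcard, hπ, mem_image]
  constructor
  · rintro ⟨hlt, e', he', heq⟩
    rwa [← injOn_pair_of_lt (h.fst_lt_snd e' he') hlt heq]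
  · exact fun he => ⟨h.fst_lt_snd e he, e, he, rfl⟩

theorem mem_matchings {n : ℕ} {π : Finpartition (Icc 1 (2 * n))} :
    π ∈ matchings n ↔ ∀ B ∈ π.parts, #B = 2 := by
  simp only [matchings, mem_filter, mem_univ, true_and, and_iff_right_iff_imp]
  intro h
  have hcard := π.sum_card_parts
  rw [sum_const_nat h, Nat.card_Icc] at hcard
  omega

theorem sum_matchings_edges {M : Type*} [AddCommMonoid M] (n : ℕ) (f : Finset (ℕ × ℕ) → M) :
    ∑ π ∈ matchings n, f (edges π) = ∑ E ∈ suffixMatchings ∅ (Icc 1 (2 * n)), f E := by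
  refine sum_bij (fun π _ => edges π) ?_ ?_ ?_ fun _ _ => rfl
  · exact fun π hπ => mem_suffixMatchings.2 (isSuffixMatching_edges (mem_matchings.1 hπ))
  · intro π hπ π' hπ' heq
    ext1
    rw [← image_pair_edges (mem_matchings.1 hπ), ← image_pair_edges (mem_matchings.1 hπ'), heq]
  · intro E hE
    obtain ⟨π, hπ, rfl⟩ := (mem_suffixMatchings.1 hE).exists_edges_eq
    exact ⟨π, mem_matchings.2 hπ, rfl⟩

theorem L_eq_dyckPrefixSum {R : Type*} [CommRing R] (p q : R) (n : ℕ) :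
    L p q n = dyckPrefixSum (fun k => pqNumber p q (k + 1)) (2 * n) 0 :=
  calc L p q n = ∑ π ∈ matchings n, p ^ crossings (edges π) * q ^ nestings (edges π) := rfl
    _ = ∑ E ∈ suffixMatchings ∅ (Icc 1 (2 * n)), p ^ crossings E * q ^ nestings E :=
      sum_matchings_edges n fun E => p ^ crossings E * q ^ nestings E
    _ = dyckPrefixSum (fun k => pqNumber p q (k + 1)) (2 * n) 0 := by
      simp [sum_suffixMatchings_pow_crossings_mul_pow_nestings]

end Matchings

end CrossNest

theorem mainTheorem10 {R : Type*} [CommRing R] (p q : R) :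
    CrossNest.IsSFraction (PowerSeries.mk fun n => CrossNest.L p q n)
      (fun k => CrossNest.pqNumber p q (k + 1)) := by
  simp only [CrossNest.L_eq_dyckPrefixSum]
  exact CrossNest.isSFraction_dyckPrefixSeries_zero _
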